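/- Let $b>-1$ be a real number. For $\eta>0$ consider the generalized Charlier weight $$w(k)=\frac{\eta^k}{(b+1)_k\,k!},\qquad k\in\{0,1,2,\dots\},\qquad (b+1)_k=(b+1)(b+2)\cdots(b+k),$$ and the linear functional $\langle\rho,p\rangle=\sum_{k=0}^\infty p(k)\,w(k)$ on real polynomials. Then for every $\eta>0$ all moments $\sum_{k\ge 0}k^m w(k)$ converge, and $\rho$ has a sequence of monic orthogonal polynomials $(P_n)_{n\ge 0}$, $\deg P_n=n$, $\langle\rho,P_nP_m\rangle=0$ for $n\neq m$, $\langle\rho,P_n^2\rangle\neq 0$. These satisfy a three-term recursion $$zP_n(z)=P_{n+1}(z)+\beta_nP_n(z)+\gamma_nP_{n-1}(z),\qquad n\ge 0,\quad \gamma_0=0,$$ whose coefficients $\beta_n=\beta_n(\eta)$, $\gamma_n=\gamma_n(\eta)$ are given by $\beta_n=\langle\rho,zP_n^2\rangle/\langle\rho,P_n^2\rangle$ and, for $n\ge1$, $\gamma_n=\langle\rho,zP_nP_{n-1}\rangle/\langle\rho,P_{n-1}^2\rangle$. Moreover, for every $n\ge 1$ the function $\gamma_n$ is positive and infinitely differentiable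 on $(0,\infty)$, and with $\vartheta_\eta=\eta\,\frac{d}{d\eta}$ it satisfies the third-order nonlinear ordinary differential equation $$\vartheta_\eta\!\left(\frac{\gamma_n}{\eta}\bigl(\vartheta_\eta^2\log\gamma_n+2\gamma_n\bigr)+n^2\frac{\eta}{\gamma_n}\right)=2\gamma_n\qquad\text{for all }\eta>0.$$ -/

import Mathlib

open Polynomial
open scoped Nat ContDiff

noncomputable section

/-- The Euler operator `ϑ_η = η d/dη`. -/
def eulerOp (f : ℝ → ℝ) : ℝ → ℝ := fun η => η * deriv f η

namespace GenCharlier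

/-- The generalized Charlier weight `w(k) = η ^ k / ((b + 1)_k k!)` on `ℕ`, where `(b + 1)_k` is the
rising factorial. -/
def weight (b η : ℝ) (k : ℕ) : ℝ :=
  η ^ k / ((ascPochhammer ℝ k).eval (b + 1) * (k ! : ℝ))

/-- The linear functional `⟨ρ, p⟩ = ∑_{k ≥ 0} p(k) w(k)`. -/
def functional (b η : ℝ) (p : ℝ[X]) : ℝ := ∑' k : ℕ, p.eval (k : ℝ) * weight b η k

/-- The monic orthogonal polynomials of the functional, by Gram-Schmidt orthogonalization of
`1, X, X ^ 2, …`. -/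
def orthoPoly (b η : ℝ) (n : ℕ) : ℝ[X] :=
  X ^ n - ∑ j : Fin n,
    C (functional b η (X ^ n * orthoPoly b η j) /
        functional b η (orthoPoly b η j * orthoPoly b η j)) * orthoPoly b η j
termination_by n
decreasing_by all_goals exact j.isLt

/-- The coefficient `β_n` of `P_n` in `X P_n` (diagonal entry of the Jacobi matrix). -/
def beta (b : ℝ) (n : ℕ) (η : ℝ) : ℝ :=
  functional b η (X * orthoPoly b η n * orthoPoly b η n) /
    functional b η (orthoPoly b η n * orthoPoly b η n)

/-- The coefficient `γ_n` of `P_{n-1}` in `X P_n` (subdiagonal entry of the Jacobi matrix), with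
`γ_0 = 0`. -/
def gamma (b : ℝ) : ℕ → ℝ → ℝ
  | 0, _ => 0
  | n + 1, η =>
    functional b η (X * orthoPoly b η (n + 1) * orthoPoly b η n) /
      functional b η (orthoPoly b η n * orthoPoly b η n)

end GenCharlier

end

/-! Two structures on the recurrence coefficients meet, with σ = z(z + b) and h_n = ⟨ρ, P_n²⟩.
Discrete side: the weight satisfies k(k + b)w(k) = ηw(k - 1), so ⟨ρ, σ p q(z - 1)⟩ = η⟨ρ, p(z + 1)
q⟩ (`functional_pearson_mul_taylor`). Taking orthogonal polynomials for p and q yields the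
Laguerre-Freud equations `laguerre_freud_one` and `laguerre_freud_two_aux`. Continuous side: ϑw(k) =
k w(k), so ϑ acts on ρ as multiplication by z. Differentiating the orthogonality relations gives the
Toda equations ϑγ_n = γ_n(β_n - β_{n-1}) and ϑβ_n = γ_{n+1} - γ_n. Applying Toda to the first
Laguerre-Freud equation brings the second into the factored form `laguerre_freud_two`. Toda also
gives ϑ² log γ_n + 2γ_n = γ_{n+1} + γ_{n-1}, so the bracket in the differential equation becomes
polynomial in the β's and γ's (`gamma_div_mul_add_eq`). One more ϑ, with Toda and the first
Laguerre-Freud equation at the two neighbouring indices, leaves 2γ_n. -/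

namespace GenCharlier

/-! ### The weight, its moments and their dependence on η -/

section Functional

variable {b : ℝ} {η : ℝ}

lemma pow_le_ascPochhammer_eval {c : ℝ} (hc : 0 < c) (k : ℕ) :
    c ^ k ≤ (ascPochhammer ℝ k).eval c := by
  induction k with
  | zero => simp
  | succ k ih =>
    rw [pow_succ, ascPochhammer_succ_eval]
    have : (0 : ℝ) ≤ k := k.cast_nonneg
    exact mul_le_mul ih (by linarith) hc.le ((by positivity : 0 ≤ c ^ k).trans ih)

lemma weight_pos (hb : -1 < b) (hη : 0 < η) (k : ℕ) : 0 < weight b η k := by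
  have := ascPochhammer_pos k (b + 1) (by linarith)
  unfold weight
  positivity

lemma weight_succ (hb : -1 < b) (k : ℕ) :
    ((k + 1 : ℕ) : ℝ) * (((k + 1 : ℕ) : ℝ) + b) * weight b η (k + 1) = η * weight b η k := by
  have h1 := ascPochhammer_pos k (b + 1) (by linarith)
  have h2 : (0 : ℝ) < b + 1 + k := by
    have : (0 : ℝ) ≤ k := k.cast_nonneg
    linarith
  have h3 : (0 : ℝ) < (k ! : ℝ) := by positivity
  unfold weight
  rw [ascPochhammer_succ_eval, Nat.factorial_succ]
  push_cast
  have h4 : (k : ℝ) + 1 ≠ 0 := by positivity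
  field_simp
  ring

/-- A summable majorant for the moments, uniform in `|y| ≤ R`. -/
lemma summable_pow_mul_abs_weight (hb : -1 < b) (m : ℕ) (R : ℝ) :
    Summable fun k : ℕ => (k : ℝ) ^ m * |weight b R k| := by
  have hc : 0 < b + 1 := by linarith
  refine Summable.of_nonneg_of_le (fun k => by positivity) (fun k => ?_)
    ((Real.summable_pow_div_factorial (Real.exp 1 * (|R| / (b + 1)))).mul_left (m ! : ℝ))
  have h1 := pow_le_ascPochhammer_eval hc k
  -- The power of k costs only a factor e^k, which the factorial absorbs.
  have h2 : (k : ℝ) ^ m ≤ m ! * Real.exp 1 ^ k := by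
    have := Real.pow_div_factorial_le_exp (k : ℝ) k.cast_nonneg m
    rw [div_le_iff₀ (by positivity)] at this
    rw [← Real.exp_nat_mul, mul_one]
    linarith
  have h3 : |weight b R k| ≤ (|R| / (b + 1)) ^ k / k ! := by
    have hp := ascPochhammer_pos k (b + 1) hc
    unfold weight
    rw [abs_div, abs_pow, abs_of_pos (by positivity : (0 : ℝ) < _ * (k ! : ℝ)), div_pow, div_div]
    gcongr
  calc (k : ℝ) ^ m * |weight b R k|
      ≤ (m ! * Real.exp 1 ^ k) * ((|R| / (b + 1)) ^ k / k !) := by gcongr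
    _ = _ := by rw [mul_pow]; ring

lemma summable_pow_mul_weight (hb : -1 < b) (η : ℝ) (m : ℕ) :
    Summable fun k : ℕ => (k : ℝ) ^ m * weight b η k := by
  refine Summable.of_norm ((summable_pow_mul_abs_weight hb m η).congr fun k => ?_)
  simp

lemma summable_eval_mul_weight (hb : -1 < b) (η : ℝ) (p : ℝ[X]) :
    Summable fun k : ℕ => p.eval (k : ℝ) * weight b η k := by
  induction p using Polynomial.induction_on' with
  | add p q hp hq => simpa [add_mul] using hp.add hq
  | monomial n a => simpa [mul_assoc] using (summable_pow_mul_weight hb η n).mul_left a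

/-- `GenCharlier.functional` as a linear map. -/
noncomputable def functionalₗ (hb : -1 < b) (η : ℝ) : ℝ[X] →ₗ[ℝ] ℝ where
  toFun := functional b η
  map_add' p q := by
    simp only [functional, eval_add, add_mul]
    exact (summable_eval_mul_weight hb η p).tsum_add (summable_eval_mul_weight hb η q)
  map_smul' c p := by
    simp only [functional, eval_smul, smul_eq_mul, mul_assoc, tsum_mul_left, RingHom.id_apply]

lemma functionalₗ_apply (hb : -1 < b) (η : ℝ) (p : ℝ[X]) :
    functionalₗ hb η p = functional b η p := rfl

/-- All weights are positive, and a nonzero polynomial cannot vanish at every natural number. All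
later divisions and uniqueness arguments rest on this definiteness. -/
lemma functional_mul_self_pos (hb : -1 < b) (hη : 0 < η) {p : ℝ[X]} (hp : p ≠ 0) :
    0 < functional b η (p * p) := by
  obtain ⟨k, hk⟩ : ∃ k : ℕ, p.eval (k : ℝ) ≠ 0 := by
    by_contra! h
    exact hp (Polynomial.eq_zero_of_infinite_isRoot p
      ((Set.infinite_range_of_injective (Nat.cast_injective (R := ℝ))).mono
        (by rintro _ ⟨k, rfl⟩; exact h k)))
  refine (summable_eval_mul_weight hb η (p * p)).tsum_pos (fun j => ?_) k ?_
  · rw [eval_mul]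
    exact mul_nonneg (mul_self_nonneg _) (weight_pos hb hη j).le
  · rw [eval_mul]
    exact mul_pos (mul_self_pos.2 hk) (weight_pos hb hη k)

/-- The Pearson equation `k (k + b) w(k) = η w(k - 1)` in terms of the functional. -/
lemma functional_pearson (hb : -1 < b) (η : ℝ) (p : ℝ[X]) :
    functional b η (X * (X + C b) * p) = η * functional b η (taylor 1 p) := by
  unfold functional
  -- The k = 0 term vanishes because of the factor X; the rest is reindexed by k + 1.
  rw [(summable_eval_mul_weight hb η _).tsum_eq_zero_add, ← tsum_mul_left]
  simp only [eval_mul, eval_add, eval_X, eval_C, taylor_eval, Nat.cast_zero, zero_mul, zero_add]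
  refine tsum_congr fun k => ?_
  have := weight_succ (η := η) hb k
  push_cast at this ⊢
  linear_combination (eval ((k : ℝ) + 1) p) * this

/-- The shift by 1 from the Pearson equation undoes the shift by -1 already placed on q. -/
lemma functional_pearson_mul_taylor (hb : -1 < b) (η : ℝ) (p q : ℝ[X]) :
    functional b η (X * (X + C b) * p * taylor (-1) q) =
      η * functional b η (taylor 1 p * q) := by
  rw [mul_assoc _ p, functional_pearson hb, taylor_mul, taylor_taylor]
  simp

lemma functional_eq_sum_range (hb : -1 < b) (η : ℝ) {p : ℝ[X]} {N : ℕ} (hp : p.natDegree < N) :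
    functional b η p = ∑ i ∈ Finset.range N, p.coeff i * functional b η (X ^ i) := by
  conv_lhs => rw [p.as_sum_range_C_mul_X_pow' hp]
  simp only [← functionalₗ_apply hb, map_sum, ← smul_eq_C_mul, map_smul, smul_eq_mul]

lemma hasDerivAt_functional_X_pow (hb : -1 < b) (hη : 0 < η) (m : ℕ) :
    HasDerivAt (fun y => functional b y (X ^ m)) (functional b η (X ^ (m + 1)) / η) η := by
  have key : HasDerivAt (fun y => ∑' k : ℕ, (k : ℝ) ^ m * weight b y k)
      (∑' k : ℕ, (k : ℝ) ^ (m + 1) * weight b η k / η) η := by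
    refine hasDerivAt_tsum_of_isPreconnected
      -- On (η/2, 2η) the weight is at most its value at 2η, and 1/y ≤ 2/η.
      (u := fun k : ℕ => (2 / η) * ((k : ℝ) ^ (m + 1) * |weight b (2 * η) k|))
      (t := Set.Ioo (η / 2) (2 * η)) (y₀ := η)
      (g' := fun (k : ℕ) (y : ℝ) => (k : ℝ) ^ (m + 1) * weight b y k / y)
      ((summable_pow_mul_abs_weight hb (m + 1) (2 * η)).mul_left _)
      isOpen_Ioo isPreconnected_Ioo ?_ ?_ ⟨by linarith, by linarith⟩
      (summable_pow_mul_weight hb η m) ⟨by linarith, by linarith⟩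
    · rintro k y ⟨hy, -⟩
      have hy0 : 0 < y := by linarith
      have h1 := ((hasDerivAt_pow k y).div_const
        ((ascPochhammer ℝ k).eval (b + 1) * (k ! : ℝ))).const_mul ((k : ℝ) ^ m)
      refine h1.congr_deriv ?_
      unfold weight
      rcases k with _ | k
      · simp
      · rw [pow_succ y, Nat.add_sub_cancel]
        field_simp
        rw [pow_succ (((k + 1 : ℕ)) : ℝ) m]
    · rintro k y ⟨hy, hy2⟩
      have hy0 : 0 < y := by linarith
      have hw : weight b y k ≤ weight b (2 * η) k := by
        have hp := ascPochhammer_pos k (b + 1) (by linarith)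
        unfold weight
        gcongr
      have hwy := weight_pos hb hy0 k
      rw [Real.norm_eq_abs, abs_of_nonneg (by positivity),
        abs_of_pos (weight_pos hb (by linarith : 0 < 2 * η) k), div_eq_inv_mul]
      have : y⁻¹ ≤ 2 / η := by
        rw [inv_le_comm₀ hy0 (by positivity), inv_div]; exact hy.le
      gcongr
  have e : functional b η (X ^ (m + 1)) / η = ∑' k : ℕ, (k : ℝ) ^ (m + 1) * weight b η k / η := by
    simp only [functional, eval_pow, eval_X, tsum_div_const]
  rw [e]
  simpa only [functional, eval_pow, eval_X] using key

lemma contDiffOn_functional_X_pow (hb : -1 < b) (m : ℕ) :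
    ContDiffOn ℝ ∞ (fun y => functional b y (X ^ m)) (Set.Ioi 0) := by
  refine contDiffOn_infty.2 fun n => ?_
  induction n generalizing m with
  | zero =>
    exact contDiffOn_zero.2 fun y hy =>
      (hasDerivAt_functional_X_pow hb hy m).continuousAt.continuousWithinAt
  | succ n ih =>
    push_cast
    refine (contDiffOn_succ_iff_deriv_of_isOpen isOpen_Ioi).2 ⟨fun y hy =>
      (hasDerivAt_functional_X_pow hb hy m).differentiableAt.differentiableWithinAt, by simp, ?_⟩
    exact ((ih (m + 1)).div contDiffOn_id fun y hy => ne_of_gt hy).congr fun y hy =>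
      (hasDerivAt_functional_X_pow hb hy m).deriv

/-- The degree bound uniform in y reduces the series to one fixed finite sum of coefficients times
moments. -/
lemma contDiffOn_functional (hb : -1 < b) {p : ℝ → ℝ[X]} {N : ℕ}
    (hN : ∀ y ∈ Set.Ioi (0 : ℝ), (p y).natDegree < N)
    (hp : ∀ i, ContDiffOn ℝ ∞ (fun y => (p y).coeff i) (Set.Ioi 0)) :
    ContDiffOn ℝ ∞ (fun y => functional b y (p y)) (Set.Ioi 0) :=
  (ContDiffOn.sum fun i (_ : i ∈ Finset.range N) =>
    (hp i).mul (contDiffOn_functional_X_pow hb i)).congr fun y hy =>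
      functional_eq_sum_range hb y (hN y hy)

/-- Leibniz rule for `⟨ρ_y, p_y⟩`, using `ϑ ρ = X ρ`. -/
lemma hasDerivAt_functional (hb : -1 < b) (hη : 0 < η) {p : ℝ → ℝ[X]} {p' : ℝ[X]} {N : ℕ}
    (hN : ∀ y ∈ Set.Ioi (0 : ℝ), (p y).natDegree < N) (hN' : p'.natDegree < N)
    (hp : ∀ i, HasDerivAt (fun y => (p y).coeff i) (p'.coeff i) η) :
    HasDerivAt (fun y => functional b y (p y))
      (functional b η p' + functional b η (X * p η) / η) η := by
  have h := HasDerivAt.fun_sum fun i (_ : i ∈ Finset.range N) =>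
    (hp i).mul (hasDerivAt_functional_X_pow hb hη i)
  have hX : functional b η (X * p η) =
      ∑ i ∈ Finset.range N, (p η).coeff i * functional b η (X ^ (i + 1)) := by
    conv_lhs => rw [(p η).as_sum_range_C_mul_X_pow' (hN η hη), Finset.mul_sum]
    simp only [← functionalₗ_apply hb, map_sum, ← smul_eq_C_mul, mul_smul_comm, map_smul,
      smul_eq_mul, ← pow_succ']
  refine (h.congr_of_eventuallyEq ?_).congr_deriv ?_
  · filter_upwards [Ioi_mem_nhds hη] with y hy
    exact functional_eq_sum_range hb y (hN y hy)
  · rw [functional_eq_sum_range hb η hN', hX, Finset.sum_div, ← Finset.sum_add_distrib]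
    exact Finset.sum_congr rfl fun i _ => by ring

end Functional

/-! ### Orthogonality and the three-term recursion -/

section Orthogonality

variable {b : ℝ} {η : ℝ}

lemma orthoPoly_monic_and_natDegree (b η : ℝ) (n : ℕ) :
    (orthoPoly b η n).Monic ∧ (orthoPoly b η n).natDegree = n := by
  induction n using Nat.strong_induction_on with
  | _ n ih =>
    have hlt : (∑ j : Fin n, C (functional b η (X ^ n * orthoPoly b η j) /
        functional b η (orthoPoly b η j * orthoPoly b η j)) * orthoPoly b η j).degree <
          ((X : ℝ[X]) ^ n).degree := by
      rw [degree_X_pow]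
      refine (degree_sum_le _ _).trans_lt ((Finset.sup_lt_iff (WithBot.bot_lt_coe n)).2 fun j _ => ?_)
      rw [← smul_eq_C_mul]
      refine (degree_smul_le _ _).trans_lt ?_
      rw [degree_eq_natDegree (ih j j.2).1.ne_zero, (ih j j.2).2]
      exact WithBot.coe_lt_coe.2 j.2
    rw [orthoPoly]
    refine ⟨(monic_X_pow n).sub_of_left hlt, ?_⟩
    rw [natDegree_eq_of_degree_eq (degree_sub_eq_left_of_degree_lt hlt), natDegree_X_pow]

lemma orthoPoly_monic (b η : ℝ) (n : ℕ) : (orthoPoly b η n).Monic :=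
  (orthoPoly_monic_and_natDegree b η n).1

@[simp] lemma natDegree_orthoPoly (b η : ℝ) (n : ℕ) : (orthoPoly b η n).natDegree = n :=
  (orthoPoly_monic_and_natDegree b η n).2

@[simp] lemma coeff_orthoPoly_self (b η : ℝ) (n : ℕ) : (orthoPoly b η n).coeff n = 1 := by
  simpa using (orthoPoly_monic b η n).coeff_natDegree

lemma coeff_orthoPoly_of_lt {n m : ℕ} (h : n < m) : (orthoPoly b η n).coeff m = 0 :=
  coeff_eq_zero_of_natDegree_lt (by simpa)

/-- The squared norm `⟨ρ, P_n ^ 2⟩`. -/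
noncomputable def normSq (b η : ℝ) (n : ℕ) : ℝ :=
  functional b η (orthoPoly b η n * orthoPoly b η n)

lemma normSq_pos (hb : -1 < b) (hη : 0 < η) (n : ℕ) : 0 < normSq b η n :=
  functional_mul_self_pos hb hη (orthoPoly_monic b η n).ne_zero

lemma functional_add (hb : -1 < b) (η : ℝ) (p q : ℝ[X]) :
    functional b η (p + q) = functional b η p + functional b η q :=
  map_add (functionalₗ hb η) p q

lemma functional_sub (hb : -1 < b) (η : ℝ) (p q : ℝ[X]) :
    functional b η (p - q) = functional b η p - functional b η q :=
  map_sub (functionalₗ hb η) p q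

lemma functional_C_mul (hb : -1 < b) (η c : ℝ) (p : ℝ[X]) :
    functional b η (C c * p) = c * functional b η p := by
  rw [← smul_eq_C_mul]
  exact map_smul (functionalₗ hb η) c p

lemma functional_orthoPoly_mul_of_lt (hb : -1 < b) (hη : 0 < η) {n m : ℕ} (h : m < n) :
    functional b η (orthoPoly b η n * orthoPoly b η m) = 0 := by
  induction n using Nat.strong_induction_on generalizing m with
  | _ n ih =>
    rw [orthoPoly, sub_mul, functional_sub hb, Finset.sum_mul, ← functionalₗ_apply hb _ (∑ _, _),
      map_sum, Finset.sum_eq_single (⟨m, h⟩ : Fin n)]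
    · rw [functionalₗ_apply, mul_assoc, functional_C_mul hb]
      exact sub_eq_zero.2 (div_mul_cancel₀ _ (normSq_pos hb hη m).ne').symm
    · intro j _ hj
      rw [functionalₗ_apply, mul_assoc, functional_C_mul hb]
      rcases lt_or_gt_of_ne (fun e => hj (Fin.ext e) : (j : ℕ) ≠ m) with h' | h'
      · rw [mul_comm (orthoPoly b η j) (orthoPoly b η m), ih m h h', mul_zero]
      · rw [ih j j.2 h', mul_zero]
    · simp

lemma functional_orthoPoly_mul_of_ne (hb : -1 < b) (hη : 0 < η) {n m : ℕ} (h : n ≠ m) :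
    functional b η (orthoPoly b η n * orthoPoly b η m) = 0 := by
  rcases lt_or_gt_of_ne h with h | h
  · rw [mul_comm, functional_orthoPoly_mul_of_lt hb hη h]
  · exact functional_orthoPoly_mul_of_lt hb hη h

lemma degree_sub_C_mul_orthoPoly_lt {q : ℝ[X]} {n : ℕ} (hq : q.degree < (n + 1 : ℕ)) :
    (q - C (q.coeff n) * orthoPoly b η n).degree < n := by
  rw [degree_lt_iff_coeff_zero] at hq ⊢
  intro m hm
  rw [coeff_sub, coeff_C_mul]
  rcases hm.eq_or_lt with rfl | hm
  · simp
  · rw [hq m hm, coeff_orthoPoly_of_lt hm]; simp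

/-- A functional vanishing against `P_0, …, P_{d-1}` vanishes on polynomials of degree `< d`. -/
lemma functional_mul_eq_zero_of_degree_lt (hb : -1 < b) {r : ℝ[X]} {d : ℕ}
    (hr : ∀ j < d, functional b η (r * orthoPoly b η j) = 0) {q : ℝ[X]} (hq : q.degree < d) :
    functional b η (r * q) = 0 := by
  induction d generalizing q with
  | zero =>
    have : q = 0 := by simpa using hq
    simp [this, functional]
  | succ d ih =>
    have h1 := ih (fun j hj => hr j (by omega)) (degree_sub_C_mul_orthoPoly_lt (b := b) (η := η) hq)
    rwa [mul_sub, functional_sub hb, mul_left_comm, functional_C_mul hb, hr d (by omega), mul_zero,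
      sub_zero] at h1

/-- Such an r is orthogonal to itself. Polynomial identities can thus be checked by pairing with the
P_j. -/
lemma eq_zero_of_functional_orthoPoly (hb : -1 < b) (hη : 0 < η) {r : ℝ[X]} {d : ℕ}
    (hd : r.degree < d) (hr : ∀ j < d, functional b η (r * orthoPoly b η j) = 0) : r = 0 := by
  by_contra h
  exact (functional_mul_self_pos hb hη h).ne' (functional_mul_eq_zero_of_degree_lt hb hr hd)

/-- Subtracting the right multiple of P_n from q lowers the degree below n. Pairings with shifted
polynomials thereby become coefficient computations. -/
lemma functional_orthoPoly_mul (hb : -1 < b) (hη : 0 < η) {n : ℕ} {q : ℝ[X]}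
    (hq : q.natDegree ≤ n) :
    functional b η (orthoPoly b η n * q) = q.coeff n * normSq b η n := by
  have hq' : q.degree < (n + 1 : ℕ) :=
    degree_le_natDegree.trans_lt (by exact_mod_cast Nat.lt_succ_of_le hq)
  have h := functional_mul_eq_zero_of_degree_lt hb
    (fun j hj => functional_orthoPoly_mul_of_lt hb hη hj)
    (degree_sub_C_mul_orthoPoly_lt (b := b) (η := η) hq')
  rw [mul_sub, functional_sub hb, mul_left_comm, functional_C_mul hb] at h
  exact sub_eq_zero.1 h

lemma functional_orthoPoly_mul_of_natDegree_lt (hb : -1 < b) (hη : 0 < η) {n : ℕ} {q : ℝ[X]}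
    (hq : q.natDegree < n) : functional b η (orthoPoly b η n * q) = 0 := by
  rw [functional_orthoPoly_mul hb hη hq.le, coeff_eq_zero_of_natDegree_lt hq, zero_mul]

lemma natDegree_X_mul_orthoPoly (b η : ℝ) (n : ℕ) : (X * orthoPoly b η n).natDegree = n + 1 := by
  rw [natDegree_X_mul (orthoPoly_monic b η n).ne_zero, natDegree_orthoPoly]

@[simp] lemma gamma_zero (b η : ℝ) : gamma b 0 η = 0 := rfl

lemma gamma_succ (hb : -1 < b) (hη : 0 < η) (n : ℕ) :
    gamma b (n + 1) η = normSq b η (n + 1) / normSq b η n := by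
  rw [gamma, mul_comm X, mul_assoc,
    functional_orthoPoly_mul hb hη (natDegree_X_mul_orthoPoly b η n).le]
  simp [normSq]

lemma gamma_succ_mul_normSq (hb : -1 < b) (hη : 0 < η) (n : ℕ) :
    gamma b (n + 1) η * normSq b η n = normSq b η (n + 1) := by
  rw [gamma_succ hb hη, div_mul_cancel₀ _ (normSq_pos hb hη n).ne']

lemma gamma_succ_pos (hb : -1 < b) (hη : 0 < η) (n : ℕ) : 0 < gamma b (n + 1) η := by
  rw [gamma_succ hb hη]
  exact div_pos (normSq_pos hb hη _) (normSq_pos hb hη _)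

lemma beta_mul_normSq (hb : -1 < b) (hη : 0 < η) (n : ℕ) :
    beta b n η * normSq b η n = functional b η (X * orthoPoly b η n * orthoPoly b η n) :=
  div_mul_cancel₀ _ (normSq_pos hb hη n).ne'

lemma three_term_recursion (hb : -1 < b) (hη : 0 < η) (n : ℕ) :
    X * orthoPoly b η n = orthoPoly b η (n + 1) + C (beta b n η) * orthoPoly b η n
      + C (gamma b n η) * orthoPoly b η (n - 1) := by
  have hdeg : (X * orthoPoly b η n - (orthoPoly b η (n + 1) + C (beta b n η) * orthoPoly b η n
      + C (gamma b n η) * orthoPoly b η (n - 1))).degree < ((n + 1 : ℕ) : WithBot ℕ) := by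
    rw [degree_lt_iff_coeff_zero]
    intro m hm
    simp only [coeff_sub, coeff_add, coeff_C_mul]
    rw [coeff_orthoPoly_of_lt (by omega : n < m), coeff_orthoPoly_of_lt (by omega : n - 1 < m)]
    rcases hm.eq_or_lt with rfl | hm
    · simp
    · rw [coeff_eq_zero_of_natDegree_lt (by rw [natDegree_X_mul_orthoPoly]; exact hm),
        coeff_orthoPoly_of_lt hm]
      simp
  refine sub_eq_zero.1 (eq_zero_of_functional_orthoPoly hb hη hdeg fun j hj => ?_)
  rw [sub_mul, add_mul, add_mul, mul_assoc (C _), mul_assoc (C _), functional_sub hb,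
    functional_add hb, functional_add hb, functional_C_mul hb, functional_C_mul hb,
    functional_orthoPoly_mul_of_ne hb hη hj.ne']
  rcases (Nat.lt_succ_iff.1 hj).eq_or_lt with rfl | hj
  · rw [← beta_mul_normSq hb hη]
    rcases j with _ | j
    · simp [normSq]
    · rw [functional_orthoPoly_mul_of_ne hb hη (by omega : j + 1 - 1 ≠ j + 1)]
      simp [normSq]
  · rw [functional_orthoPoly_mul_of_ne hb hη hj.ne', mul_comm X, mul_assoc]
    obtain ⟨n, rfl⟩ : ∃ k, n = k + 1 := ⟨n - 1, by omega⟩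
    rw [Nat.add_sub_cancel]
    rcases (Nat.lt_succ_iff.1 hj).eq_or_lt with rfl | hj
    · rw [functional_orthoPoly_mul hb hη (natDegree_X_mul_orthoPoly b η j).le,
        ← gamma_succ_mul_normSq hb hη]
      simp [normSq]
    · rw [functional_orthoPoly_mul_of_natDegree_lt hb hη
        (by rw [natDegree_X_mul_orthoPoly]; omega), functional_orthoPoly_mul_of_ne hb hη hj.ne']
      simp

end Orthogonality

/-! ### Laguerre-Freud equations from the Pearson equation -/

section LaguerreFreud

variable {b : ℝ} {η : ℝ}

lemma coeff_taylor_eq_sum_range (r : ℝ) (n d : ℕ) {p : ℝ[X]} (hp : p.natDegree ≤ n + d) :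
    (taylor r p).coeff n =
      ∑ i ∈ Finset.range (d + 1), ((i + n).choose n : ℝ) * p.coeff (i + n) * r ^ i := by
  rw [taylor_coeff, eval_eq_sum_range' (n := d + 1)]
  · simp only [hasseDeriv_coeff]
  · have := natDegree_hasseDeriv_le p n
    omega

lemma functional_orthoPoly_mul_taylor_self (hb : -1 < b) (hη : 0 < η) (r : ℝ) (n : ℕ) :
    functional b η (orthoPoly b η n * taylor r (orthoPoly b η n)) = normSq b η n := by
  rw [functional_orthoPoly_mul hb hη (by simp), coeff_taylor_eq_sum_range r n 0 (by simp)]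
  simp

lemma functional_orthoPoly_mul_taylor_of_lt (hb : -1 < b) (hη : 0 < η) (r : ℝ) {n m : ℕ}
    (h : m < n) :
    functional b η (orthoPoly b η n * taylor r (orthoPoly b η m)) = 0 :=
  functional_orthoPoly_mul_of_natDegree_lt hb hη (by simpa)

lemma functional_orthoPoly_mul_taylor_succ (hb : -1 < b) (hη : 0 < η) (r : ℝ) (n : ℕ) :
    functional b η (orthoPoly b η n * taylor r (orthoPoly b η (n + 1))) =
      (n + 1) * r * normSq b η n := by
  have hdeg : (taylor r (orthoPoly b η (n + 1)) - orthoPoly b η (n + 1)).natDegree ≤ n := by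
    rw [natDegree_le_iff_coeff_eq_zero]
    intro m hm
    rw [coeff_sub, coeff_taylor_eq_sum_range r m 0 (by simpa using hm)]
    simp
  have h := functional_orthoPoly_mul hb hη hdeg
  rw [mul_sub, functional_sub hb, functional_orthoPoly_mul_of_ne hb hη n.lt_succ_self.ne,
    sub_zero, coeff_sub, coeff_taylor_eq_sum_range r n 1 (by simp)] at h
  rw [h, Finset.sum_range_succ, Finset.sum_range_one]
  simp [add_comm 1 n]

/-- Each pairing alone involves the unknown subleading coefficient of P_{n+2}. It enters with
opposite signs, so it cancels in the second central difference. -/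
lemma functional_orthoPoly_mul_taylor_add_two (hb : -1 < b) (hη : 0 < η) (n : ℕ) :
    functional b η (orthoPoly b η n * taylor 1 (orthoPoly b η (n + 2))) +
      functional b η (orthoPoly b η n * taylor (-1) (orthoPoly b η (n + 2))) =
      (n + 2) * (n + 1) * normSq b η n := by
  set p := orthoPoly b η (n + 2) with hp
  have hdeg : (taylor 1 p + taylor (-1) p - C 2 * p).natDegree ≤ n := by
    rw [natDegree_le_iff_coeff_eq_zero]
    intro m hm
    rw [coeff_sub, coeff_add, coeff_C_mul, coeff_taylor_eq_sum_range 1 m 1 (by simp [hp]; omega),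
      coeff_taylor_eq_sum_range (-1) m 1 (by simp [hp]; omega)]
    simp only [Finset.sum_range_succ, Finset.sum_range_zero]
    simp
    ring
  have h := functional_orthoPoly_mul hb hη hdeg
  rw [mul_sub, mul_add, functional_sub hb, functional_add hb, mul_left_comm, functional_C_mul hb,
    hp, functional_orthoPoly_mul_of_ne hb hη (by omega : n ≠ n + 2), ← hp, mul_zero, sub_zero] at h
  rw [h, coeff_sub, coeff_add, coeff_C_mul, coeff_taylor_eq_sum_range 1 n 2 (by simp [hp]),
    coeff_taylor_eq_sum_range (-1) n 2 (by simp [hp])]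
  have hc : ((2 + n).choose n : ℝ) = (n + 2) * (n + 1) / 2 := by
    rw [add_comm, Nat.choose_symm_add, Nat.cast_choose_two]
    push_cast
    ring
  simp only [Finset.sum_range_succ, Finset.sum_range_zero, hc]
  rw [add_comm 2 n, hp, coeff_orthoPoly_self, zero_add n, Nat.choose_self]
  push_cast
  ring

/-- The recursion applied twice. Truncated indices are harmless: their terms carry the factor γ_0 =
0. -/
lemma sigma_mul_orthoPoly (hb : -1 < b) (hη : 0 < η) (n : ℕ) :
    X * (X + C b) * orthoPoly b η n = orthoPoly b η (n + 2)
      + C (beta b (n + 1) η + beta b n η + b) * orthoPoly b η (n + 1)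
      + C (gamma b (n + 1) η + gamma b n η + beta b n η * (beta b n η + b)) * orthoPoly b η n
      + C (gamma b n η * (beta b n η + beta b (n - 1) η + b)) * orthoPoly b η (n - 1)
      + C (gamma b n η * gamma b (n - 1) η) * orthoPoly b η (n - 2) := by
  have h0 := three_term_recursion hb hη n
  have h1 := three_term_recursion hb hη (n + 1)
  rcases n with _ | n
  · simp only [gamma_zero, zero_mul, map_add, map_mul, map_zero, zero_add, Nat.zero_sub,
      Nat.sub_self] at h0 h1 ⊢
    linear_combination (X + C b + C (beta b 0 η)) * h0 + h1
  · have h2 := three_term_recursion hb hη n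
    simp only [Nat.add_sub_cancel, map_add, map_mul] at h0 h1 h2 ⊢
    rw [show n + 1 - 2 = n - 1 by omega]
    linear_combination (X + C b + C (beta b (n + 1) η)) * h0 + h1 + C (gamma b (n + 1) η) * h2

lemma functional_sigma_mul_orthoPoly_mul (hb : -1 < b) (hη : 0 < η) (n : ℕ) (q : ℝ[X]) :
    functional b η (X * (X + C b) * orthoPoly b η n * q) =
      functional b η (orthoPoly b η (n + 2) * q)
      + (beta b (n + 1) η + beta b n η + b) * functional b η (orthoPoly b η (n + 1) * q)
      + (gamma b (n + 1) η + gamma b n η + beta b n η * (beta b n η + b)) *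
        functional b η (orthoPoly b η n * q)
      + gamma b n η * (beta b n η + beta b (n - 1) η + b) *
        functional b η (orthoPoly b η (n - 1) * q)
      + gamma b n η * gamma b (n - 1) η * functional b η (orthoPoly b η (n - 2) * q) := by
  rw [sigma_mul_orthoPoly hb hη]
  simp only [add_mul _ _ q, mul_assoc (C _), functional_add hb, functional_C_mul hb]

/-- First Laguerre-Freud equation. -/
lemma laguerre_freud_one (hb : -1 < b) (hη : 0 < η) (n : ℕ) :
    gamma b (n + 1) η * (beta b (n + 1) η + beta b n η + b - n) = (n + 1) * η := by
  -- Since q has degree n, only the P_n and P_{n-1} components of σP_{n+1} survive on the left.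
  have h := functional_pearson_mul_taylor hb η (orthoPoly b η (n + 1)) (orthoPoly b η n)
  rw [functional_sigma_mul_orthoPoly_mul hb hη,
    functional_orthoPoly_mul_taylor_of_lt hb hη _ (by omega : n < n + 1 + 2),
    functional_orthoPoly_mul_taylor_of_lt hb hη _ (by omega : n < n + 1 + 1),
    functional_orthoPoly_mul_taylor_of_lt hb hη _ (by omega : n < n + 1),
    Nat.add_sub_cancel, functional_orthoPoly_mul_taylor_self hb hη,
    mul_comm (taylor 1 _), functional_orthoPoly_mul_taylor_succ hb hη] at h
  have hn := (normSq_pos hb hη n).ne'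
  have key : gamma b n η * functional b η (orthoPoly b η (n + 1 - 2) *
      taylor (-1) (orthoPoly b η n)) = - n * normSq b η n := by
    rcases n with _ | n
    · simp
    · rw [show n + 1 + 1 - 2 = n by omega, functional_orthoPoly_mul_taylor_succ hb hη,
        ← gamma_succ_mul_normSq hb hη n]
      push_cast
      ring
  refine mul_right_cancel₀ hn ?_
  linear_combination h - gamma b (n + 1) η * key

/-- The Pearson equation for the pair P_n, P_{n-2} determines the pairing with P_n(z + 1); the
second difference identity then gives the one with P_n(z - 1). -/
lemma gamma_mul_gamma_mul_functional (hb : -1 < b) (hη : 0 < η) (n : ℕ) :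
    η * (gamma b n η * gamma b (n - 1) η * functional b η (orthoPoly b η (n - 2) *
      taylor (-1) (orthoPoly b η n))) =
      (η * (n * (n - 1)) - gamma b n η * gamma b (n - 1) η) * normSq b η n := by
  match n with
  | 0 => simp
  | 1 => simp
  | n + 2 =>
    have h := functional_pearson_mul_taylor hb η (orthoPoly b η (n + 2)) (orthoPoly b η n)
    rw [functional_sigma_mul_orthoPoly_mul hb hη,
      functional_orthoPoly_mul_taylor_of_lt hb hη _ (by omega : n < n + 2 + 2),
      functional_orthoPoly_mul_taylor_of_lt hb hη _ (by omega : n < n + 2 + 1),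
      functional_orthoPoly_mul_taylor_of_lt hb hη _ (by omega : n < n + 2),
      functional_orthoPoly_mul_taylor_of_lt hb hη _ (by omega : n < n + 2 - 1),
      Nat.add_sub_cancel, functional_orthoPoly_mul_taylor_self hb hη,
      mul_comm (taylor 1 _)] at h
    have h2 := functional_orthoPoly_mul_taylor_add_two hb hη n
    have h3 := gamma_succ_mul_normSq hb hη n
    have h4 := gamma_succ_mul_normSq hb hη (n + 1)
    rw [Nat.add_sub_cancel, show n + 2 - 1 = n + 1 by omega] at *
    push_cast
    linear_combination (gamma b (n + 2) η * gamma b (n + 1) η) * (η * h2 + h)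
      + (η * (n + 2) * (n + 1) - gamma b (n + 2) η * gamma b (n + 1) η) *
        (gamma b (n + 2) η * h3 + h4)

/-- Second Laguerre-Freud equation, as it comes from the expansion of `P_n (z ± 1)`. -/
lemma laguerre_freud_two_aux (hb : -1 < b) (hη : 0 < η) (n : ℕ) :
    η ^ 2 = η * (gamma b (n + 1) η + gamma b n η + beta b n η * (beta b n η + b)
      - n * (beta b n η + beta b (n - 1) η + b) + n * (n - 1)) - gamma b n η * gamma b (n - 1) η := by
  have h := functional_pearson_mul_taylor hb η (orthoPoly b η n) (orthoPoly b η n)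
  rw [functional_sigma_mul_orthoPoly_mul hb hη,
    functional_orthoPoly_mul_taylor_of_lt hb hη _ (by omega : n < n + 2),
    functional_orthoPoly_mul_taylor_of_lt hb hη _ (by omega : n < n + 1),
    functional_orthoPoly_mul_taylor_self hb hη,
    mul_comm (taylor 1 _), functional_orthoPoly_mul_taylor_self hb hη] at h
  have key : gamma b n η * functional b η (orthoPoly b η (n - 1) *
      taylor (-1) (orthoPoly b η n)) = - n * normSq b η n := by
    rcases n with _ | n
    · simp
    · rw [Nat.add_sub_cancel, functional_orthoPoly_mul_taylor_succ hb hη,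
        ← gamma_succ_mul_normSq hb hη n]
      push_cast
      ring
  have h2 := gamma_mul_gamma_mul_functional hb hη n
  refine mul_right_cancel₀ (normSq_pos hb hη n).ne' ?_
  linear_combination -η * h + η * (beta b n η + beta b (n - 1) η + b) * key + h2

end LaguerreFreud

/-! ### Smoothness in η and the Toda equations -/

section Toda

variable {b : ℝ} {η : ℝ}

lemma contDiffOn_coeff_mul {p q : ℝ → ℝ[X]} {s : Set ℝ}
    (hp : ∀ i, ContDiffOn ℝ ∞ (fun y => (p y).coeff i) s)
    (hq : ∀ i, ContDiffOn ℝ ∞ (fun y => (q y).coeff i) s) (i : ℕ) :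
    ContDiffOn ℝ ∞ (fun y => (p y * q y).coeff i) s := by
  simp only [coeff_mul]
  exact ContDiffOn.sum fun x _ => (hp x.1).mul (hq x.2)

lemma hasDerivAt_coeff_mul {p q : ℝ → ℝ[X]} {p' q' : ℝ[X]}
    (hp : ∀ i, HasDerivAt (fun y => (p y).coeff i) (p'.coeff i) η)
    (hq : ∀ i, HasDerivAt (fun y => (q y).coeff i) (q'.coeff i) η) (i : ℕ) :
    HasDerivAt (fun y => (p y * q y).coeff i) ((p' * q η + p η * q').coeff i) η := by
  simp only [coeff_mul, coeff_add]
  rw [← Finset.sum_add_distrib]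
  exact HasDerivAt.fun_sum fun x _ => (hp x.1).mul (hq x.2)

lemma contDiffOn_coeff_orthoPoly (hb : -1 < b) (n i : ℕ) :
    ContDiffOn ℝ ∞ (fun y => (orthoPoly b y n).coeff i) (Set.Ioi 0) := by
  induction n using Nat.strong_induction_on generalizing i with
  | _ n ih =>
    have e : (fun y => (orthoPoly b y n).coeff i) = fun y => ((X : ℝ[X]) ^ n).coeff i -
        ∑ j : Fin n, functional b y (X ^ n * orthoPoly b y j) /
          functional b y (orthoPoly b y j * orthoPoly b y j) * (orthoPoly b y j).coeff i := by
      funext y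
      rw [orthoPoly, coeff_sub, finsetSum_coeff]
      simp only [coeff_C_mul]
    rw [e]
    refine contDiffOn_const.sub (ContDiffOn.sum fun j _ => ((ContDiffOn.div ?_ ?_ ?_).mul
      (ih j j.2 i)))
    · refine contDiffOn_functional hb (N := n + j + 1) (fun y _ => Nat.lt_succ_of_le ?_)
        (contDiffOn_coeff_mul (fun _ => contDiffOn_const) (ih j j.2))
      exact natDegree_mul_le.trans (by simp)
    · refine contDiffOn_functional hb (N := j + j + 1) (fun y _ => Nat.lt_succ_of_le ?_)
        (contDiffOn_coeff_mul (ih j j.2) (ih j j.2))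
      exact natDegree_mul_le.trans (by simp)
    · exact fun y hy => (normSq_pos hb hy j).ne'

lemma contDiffOn_normSq (hb : -1 < b) (n : ℕ) :
    ContDiffOn ℝ ∞ (fun y => normSq b y n) (Set.Ioi 0) := by
  refine contDiffOn_functional hb (N := n + n + 1) (fun y _ => Nat.lt_succ_of_le ?_)
    (contDiffOn_coeff_mul (contDiffOn_coeff_orthoPoly hb n) (contDiffOn_coeff_orthoPoly hb n))
  exact natDegree_mul_le.trans (by simp)

lemma contDiffOn_gamma (hb : -1 < b) (n : ℕ) : ContDiffOn ℝ ∞ (gamma b n) (Set.Ioi 0) := by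
  rcases n with _ | n
  · exact contDiffOn_const (c := (0 : ℝ))
  · exact ((contDiffOn_normSq hb (n + 1)).div (contDiffOn_normSq hb n)
      fun y hy => (normSq_pos hb hy n).ne').congr fun y hy => gamma_succ hb hy n

/-- The coefficientwise derivative of `P_n` in `η`. -/
noncomputable def orthoPolyDeriv (b η : ℝ) (n : ℕ) : ℝ[X] :=
  ∑ i ∈ Finset.range n, C (deriv (fun y => (orthoPoly b y n).coeff i) η) * X ^ i

lemma degree_orthoPolyDeriv_lt (b η : ℝ) (n : ℕ) : (orthoPolyDeriv b η n).degree < n := by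
  rw [degree_lt_iff_coeff_zero]
  intro m hm
  simp only [orthoPolyDeriv, finsetSum_coeff, coeff_C_mul_X_pow]
  refine Finset.sum_eq_zero fun i hi => if_neg ?_
  have := Finset.mem_range.1 hi
  omega

lemma natDegree_orthoPolyDeriv_le (b η : ℝ) (n : ℕ) : (orthoPolyDeriv b η n).natDegree ≤ n :=
  natDegree_le_of_degree_le (degree_orthoPolyDeriv_lt b η n).le

/-- The coefficient of index n is constantly 1 and higher ones vanish, so truncating
`orthoPolyDeriv` below n loses nothing. -/
lemma hasDerivAt_coeff_orthoPoly (hb : -1 < b) (hη : 0 < η) (n i : ℕ) :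
    HasDerivAt (fun y => (orthoPoly b y n).coeff i) ((orthoPolyDeriv b η n).coeff i) η := by
  have hd := (((contDiffOn_coeff_orthoPoly hb n i).differentiableOn (by simp)).differentiableAt
    (Ioi_mem_nhds hη)).hasDerivAt
  refine hd.congr_deriv ?_
  simp only [orthoPolyDeriv, finsetSum_coeff, coeff_C_mul_X_pow, Finset.sum_ite_eq,
    Finset.mem_range]
  split_ifs with h
  · rfl
  · rcases (not_lt.1 h).eq_or_lt with rfl | h
    · simp
    · simp [coeff_orthoPoly_of_lt h]

lemma hasDerivAt_functional_orthoPoly_mul (hb : -1 < b) (hη : 0 < η) (n m : ℕ) :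
    HasDerivAt (fun y => functional b y (orthoPoly b y n * orthoPoly b y m))
      (functional b η (orthoPolyDeriv b η n * orthoPoly b η m)
        + functional b η (orthoPoly b η n * orthoPolyDeriv b η m)
        + functional b η (X * orthoPoly b η n * orthoPoly b η m) / η) η := by
  rw [mul_assoc X, ← functional_add hb]
  refine hasDerivAt_functional hb hη (N := n + m + 1) (fun y _ => Nat.lt_succ_of_le ?_)
    (Nat.lt_succ_of_le ?_)
    (hasDerivAt_coeff_mul (hasDerivAt_coeff_orthoPoly hb hη n) (hasDerivAt_coeff_orthoPoly hb hη m))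
  · exact natDegree_mul_le.trans (by simp)
  · refine natDegree_add_le_of_degree_le (natDegree_mul_le.trans ?_) (natDegree_mul_le.trans ?_)
    · have := natDegree_orthoPolyDeriv_le b η n
      simpa
    · have := natDegree_orthoPolyDeriv_le b η m
      simpa

lemma functional_orthoPoly_mul_orthoPolyDeriv (hb : -1 < b) (hη : 0 < η) {n m : ℕ} (h : m ≤ n) :
    functional b η (orthoPoly b η n * orthoPolyDeriv b η m) = 0 :=
  functional_mul_eq_zero_of_degree_lt hb (fun _ hj => functional_orthoPoly_mul_of_lt hb hη hj)
    ((degree_orthoPolyDeriv_lt b η m).trans_le (by exact_mod_cast h))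

/-- P_n is orthogonal to its own η-derivative, so only the variation of ρ contributes. -/
lemma hasDerivAt_normSq (hb : -1 < b) (hη : 0 < η) (n : ℕ) :
    HasDerivAt (fun y => normSq b y n) (beta b n η * normSq b η n / η) η := by
  refine (hasDerivAt_functional_orthoPoly_mul hb hη n n).congr_deriv ?_
  rw [mul_comm (orthoPolyDeriv b η n), functional_orthoPoly_mul_orthoPolyDeriv hb hη le_rfl,
    beta_mul_normSq hb hη]
  ring

/-- The Toda equation `ϑ γ_n = γ_n (β_n - β_{n-1})`. -/
lemma hasDerivAt_gamma (hb : -1 < b) (hη : 0 < η) (n : ℕ) :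
    HasDerivAt (gamma b n) (gamma b n η * (beta b n η - beta b (n - 1) η) / η) η := by
  rcases n with _ | n
  · exact (hasDerivAt_const η (0 : ℝ)).congr_deriv (by simp)
  · have h := (hasDerivAt_normSq hb hη (n + 1)).div (hasDerivAt_normSq hb hη n)
      (normSq_pos hb hη n).ne'
    refine (h.congr_of_eventuallyEq ?_).congr_deriv ?_
    · filter_upwards [Ioi_mem_nhds hη] with y hy
      exact gamma_succ hb hy n
    · have := normSq_pos hb hη n
      rw [gamma_succ hb hη, Nat.add_sub_cancel]
      field_simp

lemma functional_X_mul_orthoPoly_mul_of_lt (hb : -1 < b) (hη : 0 < η) {n j : ℕ} (h : j < n) :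
    functional b η (X * orthoPoly b η n * orthoPoly b η j) =
      gamma b n η * functional b η (orthoPoly b η (n - 1) * orthoPoly b η j) := by
  rw [three_term_recursion hb hη, add_mul, add_mul, mul_assoc (C _), mul_assoc (C _),
    functional_add hb, functional_add hb, functional_C_mul hb, functional_C_mul hb,
    functional_orthoPoly_mul_of_lt hb hη h, functional_orthoPoly_mul_of_lt hb hη (by omega)]
  ring

/-- `ϑ P_n = -γ_n P_{n-1}`. -/
lemma orthoPolyDeriv_eq (hb : -1 < b) (hη : 0 < η) (n : ℕ) :
    orthoPolyDeriv b η n = C (-(gamma b n η / η)) * orthoPoly b η (n - 1) := by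
  rcases n with _ | n
  · simp [orthoPolyDeriv]
  have hdeg : (C (-(gamma b (n + 1) η / η)) * orthoPoly b η n).degree < (n + 1 : ℕ) := by
    refine degree_le_natDegree.trans_lt (WithBot.coe_lt_coe.2 (Nat.lt_succ_of_le ?_))
    exact (natDegree_C_mul_le _ _).trans (natDegree_orthoPoly b η n).le
  refine sub_eq_zero.1 (eq_zero_of_functional_orthoPoly hb hη (d := n + 1)
    ((degree_sub_le _ _).trans_lt (max_lt (degree_orthoPolyDeriv_lt b η _) hdeg)) fun j hj => ?_)
  -- Orthogonality holds for all y near η, so its derivative vanishes as well.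
  have h0 : HasDerivAt (fun y => functional b y (orthoPoly b y (n + 1) * orthoPoly b y j)) 0 η := by
    refine (hasDerivAt_const η (0 : ℝ)).congr_of_eventuallyEq ?_
    filter_upwards [Ioi_mem_nhds hη] with y hy
    exact functional_orthoPoly_mul_of_lt hb hy hj
  have h := (hasDerivAt_functional_orthoPoly_mul hb hη (n + 1) j).unique h0
  rw [functional_orthoPoly_mul_orthoPolyDeriv hb hη hj.le,
    functional_X_mul_orthoPoly_mul_of_lt hb hη hj] at h
  rw [sub_mul, mul_assoc (C _), functional_sub hb, functional_C_mul hb]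
  linear_combination h

/-- This makes β_n a difference of subleading coefficients, whose derivatives are known from ϑP_n.
Multiplying by X avoids the index n - 1 and gives 0 for n = 0. -/
lemma beta_eq_coeff_sub (hb : -1 < b) (hη : 0 < η) (n : ℕ) :
    beta b n η = (X * orthoPoly b η n).coeff n - (X * orthoPoly b η (n + 1)).coeff (n + 1) := by
  rw [coeff_X_mul, three_term_recursion hb hη, coeff_add, coeff_add, coeff_C_mul, coeff_C_mul]
  rcases n with _ | n
  · simp
  · rw [coeff_orthoPoly_of_lt (by omega : n + 1 - 1 < n + 1)]
    simp

lemma hasDerivAt_coeff_X_mul_orthoPoly (hb : -1 < b) (hη : 0 < η) (n : ℕ) :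
    HasDerivAt (fun y => (X * orthoPoly b y n).coeff n) (-(gamma b n η / η)) η := by
  rcases n with _ | n
  · simpa using hasDerivAt_const η (0 : ℝ)
  · simp only [coeff_X_mul]
    refine (hasDerivAt_coeff_orthoPoly hb hη (n + 1) n).congr_deriv ?_
    rw [orthoPolyDeriv_eq hb hη, coeff_C_mul]
    simp

/-- The Toda equation `ϑ β_n = γ_{n+1} - γ_n`. -/
lemma hasDerivAt_beta (hb : -1 < b) (hη : 0 < η) (n : ℕ) :
    HasDerivAt (beta b n) ((gamma b (n + 1) η - gamma b n η) / η) η := by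
  refine (((hasDerivAt_coeff_X_mul_orthoPoly hb hη n).sub
    (hasDerivAt_coeff_X_mul_orthoPoly hb hη (n + 1))).congr_of_eventuallyEq ?_).congr_deriv (by ring)
  filter_upwards [Ioi_mem_nhds hη] with y hy
  exact beta_eq_coeff_sub hb hy n

end Toda

/-! ### Elimination and the differential equation -/

section ODE

variable {b : ℝ} {η : ℝ}

lemma laguerre_freud_one' (hb : -1 < b) (hη : 0 < η) (n : ℕ) :
    gamma b n η * (beta b n η + beta b (n - 1) η + b - n + 1) = n * η := by
  rcases n with _ | n
  · simp
  · have := laguerre_freud_one hb hη n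
    rw [Nat.add_sub_cancel]
    push_cast
    linear_combination this

/-- The `η`-derivative of the first Laguerre-Freud equation. -/
lemma gamma_add_two_sub_gamma (hb : -1 < b) (hη : 0 < η) (n : ℕ) :
    gamma b (n + 2) η - gamma b n η =
      (beta b (n + 1) η + beta b n η + b - n) * (1 - (beta b (n + 1) η - beta b n η)) := by
  have h1 := ((hasDerivAt_gamma hb hη (n + 1)).mul
    ((((hasDerivAt_beta hb hη (n + 1)).add (hasDerivAt_beta hb hη n)).add_const b).sub_const (n : ℝ)))
  have h2 : HasDerivAt (fun y : ℝ => ((n : ℝ) + 1) * y) ((n + 1) * 1) η :=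
    (hasDerivAt_id η).const_mul _
  have h := h1.unique (h2.congr_of_eventuallyEq (by
    filter_upwards [Ioi_mem_nhds hη] with y hy
    exact laguerre_freud_one hb hy n))
  have h3 := laguerre_freud_one hb hη n
  simp only [Nat.add_sub_cancel, Pi.add_apply] at h
  field_simp at h
  refine mul_left_cancel₀ (gamma_succ_pos hb hη n).ne' ?_
  linear_combination h - h3

/-- Second Laguerre-Freud equation. -/
lemma laguerre_freud_two (hb : -1 < b) (hη : 0 < η) (n : ℕ) :
    (gamma b (n + 1) η - η) * (gamma b n η - η) =
      η * ((beta b n η - n) * (beta b n η - n + b)) := by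
  have h := laguerre_freud_two_aux hb hη n
  rcases n with _ | n
  · simp only [gamma_zero, CharP.cast_eq_zero] at h ⊢
    linear_combination h
  · have h1 := laguerre_freud_one hb hη n
    have h2 := gamma_add_two_sub_gamma hb hη n
    simp only [Nat.add_sub_cancel] at h ⊢
    push_cast at h ⊢
    -- The differentiated first equation trades γ_{n+1}γ_n for γ_{n+2}γ_{n+1}, up to a multiple of
    -- γ_{n+1}(β_{n+1} + β_n + b - n) = (n + 1)η.
    linear_combination h + gamma b (n + 1) η * h2
      + (1 - (beta b (n + 1) η - beta b n η)) * h1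

lemma eulerOp_eulerOp_log_gamma (hb : -1 < b) (hη : 0 < η) (n : ℕ) :
    eulerOp (eulerOp fun y => Real.log (gamma b (n + 1) y)) η =
      gamma b (n + 2) η - 2 * gamma b (n + 1) η + gamma b n η := by
  have h1 : ∀ y ∈ Set.Ioi (0 : ℝ), eulerOp (fun y => Real.log (gamma b (n + 1) y)) y =
      beta b (n + 1) y - beta b n y := fun y hy => by
    have hy' : y ≠ 0 := ne_of_gt hy
    have hg := (gamma_succ_pos hb hy n).ne'
    rw [eulerOp, ((hasDerivAt_gamma hb hy (n + 1)).log hg).deriv, Nat.add_sub_cancel]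
    field_simp
  have h2 : HasDerivAt (eulerOp fun y => Real.log (gamma b (n + 1) y)) _ η :=
    ((hasDerivAt_beta hb hη (n + 1)).sub (hasDerivAt_beta hb hη n)).congr_of_eventuallyEq
      (by filter_upwards [Ioi_mem_nhds hη] with y hy using h1 y hy)
  rw [eulerOp, h2.deriv]
  field_simp
  ring

/-- By the Laguerre-Freud equations the quantity under `ϑ` in the differential equation is a
polynomial in the recursion coefficients. -/
lemma gamma_div_mul_add_eq (hb : -1 < b) (hη : 0 < η) (n : ℕ) :
    gamma b (n + 1) η / η * (eulerOp (eulerOp fun y => Real.log (gamma b (n + 1) y)) η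
        + 2 * gamma b (n + 1) η) + ((n + 1 : ℕ) : ℝ) ^ 2 * (η / gamma b (n + 1) η) =
      gamma b (n + 2) η + 2 * gamma b (n + 1) η + gamma b n η - 2 * η
        + (beta b (n + 1) η - (n + 1)) * (beta b (n + 1) η - (n + 1) + b)
        + (beta b n η - n) * (beta b n η - n + b)
        + (n + 1) * (beta b (n + 1) η + beta b n η + b - n) := by
  have hg := (gamma_succ_pos hb hη n).ne'
  have h1 := laguerre_freud_one hb hη n
  have h2 := laguerre_freud_two hb hη n
  have h3 := laguerre_freud_two hb hη (n + 1)
  rw [eulerOp_eulerOp_log_gamma hb hη]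
  push_cast at h3 ⊢
  have e : ((n : ℝ) + 1) ^ 2 * (η / gamma b (n + 1) η) =
      (n + 1) * (beta b (n + 1) η + beta b n η + b - n) := by
    field_simp
    linear_combination -h1
  rw [e]
  field_simp
  -- The product γ_{n+1}(γ_{n+2} + γ_n) comes from adding the second equation at n and n + 1.
  linear_combination h2 + h3

lemma eulerOp_gamma_eq (hb : -1 < b) (hη : 0 < η) (n : ℕ) :
    eulerOp (fun x => gamma b (n + 1) x / x *
        (eulerOp (eulerOp fun y => Real.log (gamma b (n + 1) y)) x + 2 * gamma b (n + 1) x)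
        + ((n + 1 : ℕ) : ℝ) ^ 2 * (x / gamma b (n + 1) x)) η = 2 * gamma b (n + 1) η := by
  have g0 := hasDerivAt_gamma hb hη n
  have g1 := hasDerivAt_gamma hb hη (n + 1)
  have g2 := hasDerivAt_gamma hb hη (n + 2)
  have b0 := hasDerivAt_beta hb hη n
  have b1 := hasDerivAt_beta hb hη (n + 1)
  have b1' := b1.sub_const ((n : ℝ) + 1)
  have b0' := b0.sub_const (n : ℝ)
  have h := ((((((g2.add (g1.const_mul 2)).add g0).sub ((hasDerivAt_id η).const_mul 2)).add
    (b1'.mul (b1'.add_const b))).add (b0'.mul (b0'.add_const b))).add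
    ((((b1.add b0).add_const b).sub_const (n : ℝ)).const_mul ((n : ℝ) + 1)))
  rw [eulerOp, (h.congr_of_eventuallyEq (by
    filter_upwards [Ioi_mem_nhds hη] with y hy
    exact gamma_div_mul_add_eq hb hy n)).deriv]
  have l0 := laguerre_freud_one' hb hη n
  have l2 := laguerre_freud_one hb hη (n + 1)
  simp only [Nat.add_sub_cancel, show n + 2 - 1 = n + 1 by omega] at l0 l2 ⊢
  push_cast at l2
  field_simp
  -- β_{n+2} and β_{n-1} occur only through the neighbouring first equations, whose right sides
  -- differ by (n + 2)η - nη = 2η; this cancels the derivative of -2η.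
  linear_combination l2 - l0

end ODE

end GenCharlier

theorem mainTheorem3 (b : ℝ) (hb : -1 < b) :
    -- for every `η > 0` the moments converge, the polynomials are monic and orthogonal, and
    -- `β_n`, `γ_n` are the coefficients of their three term recursion
    (∀ η : ℝ, 0 < η →
      (∀ m : ℕ, Summable fun k : ℕ => (k : ℝ) ^ m * GenCharlier.weight b η k) ∧
      (∀ n : ℕ, (GenCharlier.orthoPoly b η n).Monic ∧
        (GenCharlier.orthoPoly b η n).natDegree = n) ∧
      (∀ n m : ℕ, n ≠ m → GenCharlier.functional b η
        (GenCharlier.orthoPoly b η n * GenCharlier.orthoPoly b η m) = 0) ∧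
      (∀ n : ℕ, GenCharlier.functional b η
        (GenCharlier.orthoPoly b η n * GenCharlier.orthoPoly b η n) ≠ 0) ∧
      (∀ n : ℕ, X * GenCharlier.orthoPoly b η n =
        GenCharlier.orthoPoly b η (n + 1)
          + C (GenCharlier.beta b n η) * GenCharlier.orthoPoly b η n
          + C (GenCharlier.gamma b n η) * GenCharlier.orthoPoly b η (n - 1))) ∧
    -- for every `n ≥ 1`, `γ_n` is positive and smooth on `(0, ∞)` and solves the third order ODE
    (∀ n : ℕ, 1 ≤ n →
      (∀ η : ℝ, 0 < η → 0 < GenCharlier.gamma b n η) ∧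
      ContDiffOn ℝ ∞ (GenCharlier.gamma b n) (Set.Ioi 0) ∧
      ∀ η : ℝ, 0 < η →
        eulerOp (fun x : ℝ =>
          GenCharlier.gamma b n x / x *
              (eulerOp (eulerOp fun y : ℝ => Real.log (GenCharlier.gamma b n y)) x
                + 2 * GenCharlier.gamma b n x)
            + (n : ℝ) ^ 2 * (x / GenCharlier.gamma b n x)) η
          = 2 * GenCharlier.gamma b n η) := by
  refine ⟨fun η hη => ⟨GenCharlier.summable_pow_mul_weight hb η,
    GenCharlier.orthoPoly_monic_and_natDegree b η,
    fun n m h => GenCharlier.functional_orthoPoly_mul_of_ne hb hη h,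
    fun n => (GenCharlier.normSq_pos hb hη n).ne',
    GenCharlier.three_term_recursion hb hη⟩, fun n hn => ?_⟩
  obtain ⟨n, rfl⟩ : ∃ k, n = k + 1 := ⟨n - 1, by omega⟩
  exact ⟨fun η hη => GenCharlier.gamma_succ_pos hb hη n, GenCharlier.contDiffOn_gamma hb (n + 1),
    fun η hη => GenCharlier.eulerOp_gamma_eq hb hη n⟩
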